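/- For $n \ge 1$ let $\mathcal{T}$ be a tree chosen uniformly at random from all labelled trees on the vertex set $[n]=\{1,\dots,n\}$. For $K \in \mathbb{N}$, call a vertex $v$ of $\mathcal{T}$ \emph{internal} if there is no edge $e$ of $\mathcal{T}$ incident to $v$ such that the component containing $v$ of the forest obtained from $\mathcal{T}$ by removing $e$ (rooted at $v$ and relabelled in an order-preserving way) is a rooted labelled tree on at most $K$ vertices. Let $R=R_K(\mathcal{T})$ be the set of internal vertices, and let $$h(K) := 1 - \sum_{k=1}^{K} \frac{(k/e)^k}{k\cdot k!}.$$ Then for every fixed $K \in \mathbb{N}$, asymptotically almost surely $|R|/n \sim h(K)$ as $n \to \infty$; that is, for every $\varepsilon > 0$, $$\lim_{n\to\infty} \mathbb{P}\left( \left| \frac{|R|}{n\, h(K)} - 1 \right| \le \varepsilon \right) = 1.$$ Moreover, $h(K) = \Theta(1/\sqrt{K})$ as $K \to \infty$. -/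

import Mathlib

namespace RandomTree

/-- The vertex set of the component containing `v` after the edge `vw` is removed from `G`. -/
def branch {n : ℕ} (G : SimpleGraph (Fin n)) (v w : Fin n) : Set (Fin n) :=
  {u | (G.deleteEdges {s(v, w)}).Reachable v u}

/-- The vertex `v` of `G` is of type `(T, r)`, where `T` is a graph on `k` labelled vertices and `r`
is one of them: for some edge `vw` of `G`, the component of `v` after removing `vw`, rooted at `v`
and relabelled with the labels of `Fin k` so that the relative order is preserved, is `(T, r)`. -/
def IsOfType {n : ℕ} (G : SimpleGraph (Fin n)) (v : Fin n)
    {k : ℕ} (T : SimpleGraph (Fin k)) (r : Fin k) : Prop :=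
  ∃ w, G.Adj v w ∧ ∃ e : Fin k ≃o branch G v w,
    (e r : Fin n) = v ∧
      ∀ i j, T.Adj i j ↔ (G.deleteEdges {s(v, w)}).Adj (e i) (e j)

/-- The internal vertices of `G`: those that are not of type `(T, r)` for any rooted labelled
tree `(T, r)` on at most `K` vertices. -/
def internalVertices (K : ℕ) {n : ℕ} (G : SimpleGraph (Fin n)) : Set (Fin n) :=
  {v | ¬ ∃ k : ℕ, k ≤ K ∧ ∃ (T : SimpleGraph (Fin k)) (r : Fin k), T.IsTree ∧ IsOfType G v T r}

/-- The law of a uniformly random labelled tree on `n` vertices. -/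
noncomputable def law (n : ℕ) : MeasureTheory.Measure (SimpleGraph (Fin n)) :=
  ProbabilityTheory.uniformOn {G | G.IsTree}

/-- The limiting proportion `1 - ∑_{k=1}^K (k/e)^k / (k * k!)`. -/
noncomputable def h (K : ℕ) : ℝ :=
  1 - ∑ k ∈ Finset.Icc 1 K, ((k : ℝ) / Real.exp 1) ^ k / ((k : ℝ) * (k.factorial : ℝ))

end RandomTree

/-!
Call one side of an edge of a tree a branch, rooted at its end of that edge. A vertex is not
internal if and only if it is the root of a branch with at most `K` vertices. When `n > 2 K` two
such branches are nested or disjoint, so no vertex is the root of two of them, and `|R|` is `n`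
minus the number of such branches.

A tree with a distinguished branch on the vertex set `S` is a rooted tree on `S` glued to a rooted
tree on the complement. Since a tree has twice as many branches as edges, this yields a recursion
for the number of trees, which Abel's identity solves (Cayley's formula), and then the mean number
of branches with at most `K` vertices, which is asymptotic to `(1 - h K) n`. Cutting off a first
branch reduces ordered pairs of disjoint branches to the mean on fewer vertices, and at most
`2 K n` pairs are nested, so the mean square is asymptotically the square of the mean and
Chebyshev's inequality applies.

The summands of `1 - h K` are the Borel distribution. By Abel's identity its renewal sequence is
`u m = (m / e) ^ m / m!`, which is of order `1 / √m` by Stirling's formula. Since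
`∑_{j ≤ n} u j * h (n - j) = 1` and `h` is decreasing, `h n` is at most of order `1 / √n`; it is at
least of that order because it exceeds the sum of `u k / k` over `n < k ≤ 2 n`.
-/

namespace RandomTree

open Finset Filter Topology MeasureTheory ProbabilityTheory

/-! ### Rooted trees and Abel's identity -/

/-- The number `k ^ (k - 1)` of rooted labelled trees on `k` vertices; it is `0` for `k = 0`, where
the formula would read `1`. -/
def rootedCount : ℕ → ℕ
  | 0 => 0
  | k + 1 => (k + 1) ^ k

theorem rootedCount_succ (k : ℕ) : rootedCount (k + 1) = (k + 1) ^ k := rfl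

theorem mul_rootedCount {k : ℕ} (hk : k ≠ 0) : k * rootedCount k = k ^ k := by
  obtain ⟨k, rfl⟩ := Nat.exists_eq_succ_of_ne_zero hk
  rw [rootedCount_succ, pow_succ']

theorem rootedCount_pos {k : ℕ} (hk : k ≠ 0) : 0 < rootedCount k := by
  obtain ⟨k, rfl⟩ := Nat.exists_eq_succ_of_ne_zero hk
  exact pow_pos k.succ_pos k

theorem rootedCount_ne_zero {n : ℕ} (hn : n ≠ 0) : (rootedCount n : ℝ) ≠ 0 :=
  Nat.cast_ne_zero.2 (rootedCount_pos hn).ne'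

section Abel

variable {R : Type*} [CommRing R]

theorem neg_pow_mul_rootedCount {m k : ℕ} (hm : 2 ≤ m) (hk : k ≤ m) :
    (-k : R) ^ (m - k) * rootedCount k = (-1) ^ (m - k) * (k : R) ^ (m - 1) := by
  obtain _ | k := k
  · simp [rootedCount, show m - 1 ≠ 0 by omega]
  · rw [rootedCount_succ, neg_pow, mul_assoc, Nat.cast_pow, ← pow_add,
      show m - (k + 1) + k = m - 1 by omega]

/-- For `2 ≤ m` the sum is the `m`-th finite difference of a polynomial of degree `m - 1`. -/
theorem sum_choose_mul_neg_pow_mul_rootedCount (m : ℕ) :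
    ∑ k ∈ range (m + 1), (m.choose k : R) * ((-k) ^ (m - k) * rootedCount k) =
      if m = 1 then 1 else 0 := by
  rcases m with _ | _ | m
  · simp [rootedCount]
  · simp [sum_range_succ, rootedCount]
  · have difference_eq_zero : (fwdDiff (1 : R))^[m + 2] (fun x : R => x ^ (m + 1)) 0 = 0 := by
      rw [fwdDiff_iter_pow_eq_zero_of_lt (by omega), Pi.zero_apply]
    rw [fwdDiff_iter_eq_sum_shift] at difference_eq_zero
    rw [if_neg (by omega), ← difference_eq_zero]
    refine sum_congr rfl fun k hk => ?_
    rw [neg_pow_mul_rootedCount (by omega) (mem_range_succ_iff.1 hk)]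
    simp only [zsmul_eq_mul, nsmul_eq_mul, mul_one, zero_add]
    push_cast
    ring

/-- **Abel's identity**, with the two factors of each summand exchanged. -/
theorem sum_choose_mul_rootedCount_mul_sub_pow (n : ℕ) (x : R) :
    ∑ k ∈ range (n + 1), (n.choose k : R) * (rootedCount k * (x - k) ^ (n - k)) =
      n * x ^ (n - 1) := by
  have expand (k : ℕ) : (n.choose k : R) * (rootedCount k * (x - k) ^ (n - k)) =
      ∑ j ∈ range (n - k + 1), (n.choose j * x ^ j) *
        ((n - j).choose k * ((-k : R) ^ (n - j - k) * rootedCount k)) := by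
    rw [sub_eq_add_neg, add_pow, mul_sum, mul_sum]
    refine sum_congr rfl fun j _ => ?_
    have choose_mul_choose :
        (n.choose k : R) * (n - k).choose j = n.choose j * (n - j).choose k := by
      have hk := Nat.choose_mul (n := n) (Nat.le_add_right k j)
      have hj := Nat.choose_mul (n := n) (Nat.le_add_left j k)
      rw [← Nat.choose_symm_add, hk, Nat.add_sub_cancel_left, Nat.add_sub_cancel_right] at hj
      rw [← Nat.cast_mul, hj, Nat.cast_mul]
    rw [Nat.sub_right_comm]
    linear_combination (rootedCount k * (x ^ j * (-k) ^ (n - j - k))) * choose_mul_choose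
  have swap_indices : ∀ k j, k ∈ range (n + 1) ∧ j ∈ range (n - k + 1) ↔
      k ∈ range (n - j + 1) ∧ j ∈ range (n + 1) := by
    simp only [mem_range]
    omega
  rw [sum_congr rfl fun k _ => expand k, sum_comm' swap_indices]
  simp_rw [← mul_sum, sum_choose_mul_neg_pow_mul_rootedCount]
  obtain rfl | hn := eq_or_ne n 0
  · simp
  rw [sum_eq_single (n - 1)]
  · rw [if_pos (by omega), Nat.choose_symm (by omega), Nat.choose_one_right, mul_one]
  · intro j hj hj'
    rw [if_neg (by have := mem_range.1 hj; omega), mul_zero]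
  · exact fun h => absurd (mem_range.2 (by omega)) h

end Abel

theorem sum_antidiagonal_choose_mul_rootedCount_mul_pow {n : ℕ} (hn : n ≠ 0) :
    ∑ p ∈ antidiagonal n, n.choose p.1 * (rootedCount p.1 * p.2 ^ p.2) = n ^ n := by
  have abel := sum_choose_mul_rootedCount_mul_sub_pow n (n : ℤ)
  rw [← pow_succ', Nat.sub_add_cancel (by omega)] at abel
  rw [Nat.sum_antidiagonal_eq_sum_range_succ (fun i j => n.choose i * (rootedCount i * j ^ j))]
  zify
  rw [← abel]
  refine sum_congr rfl fun k hk => ?_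
  rw [Nat.cast_sub (mem_range_succ_iff.1 hk)]

theorem sum_antidiagonal_choose_mul_rootedCount_mul_rootedCount {n : ℕ} (hn : n ≠ 0) :
    n * ∑ p ∈ antidiagonal n, n.choose p.1 * (rootedCount p.1 * rootedCount p.2) +
      2 * rootedCount n = 2 * n ^ n := by
  have swap : ∑ p ∈ antidiagonal n, n.choose p.1 * (p.1 * rootedCount p.1 * rootedCount p.2) =
      ∑ p ∈ antidiagonal n, n.choose p.1 * (rootedCount p.1 * (p.2 * rootedCount p.2)) := by
    rw [← Nat.sum_antidiagonal_swap]
    refine sum_congr rfl fun p hp => ?_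
    rw [HasAntidiagonal.mem_antidiagonal] at hp
    rw [Prod.fst_swap, Prod.snd_swap, Nat.choose_symm_of_eq_add (hp.symm.trans (add_comm _ _))]
    ring
  have split : n * ∑ p ∈ antidiagonal n, n.choose p.1 * (rootedCount p.1 * rootedCount p.2) =
      2 * ∑ p ∈ antidiagonal n, n.choose p.1 * (rootedCount p.1 * (p.2 * rootedCount p.2)) := by
    rw [two_mul]
    nth_rw 1 [← swap]
    rw [mul_sum, ← sum_add_distrib]
    refine sum_congr rfl fun p hp => ?_
    rw [← HasAntidiagonal.mem_antidiagonal.1 hp]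
    ring
  have abel : ∑ p ∈ antidiagonal n, n.choose p.1 * (rootedCount p.1 * (p.2 * rootedCount p.2)) +
      rootedCount n = n ^ n := by
    obtain ⟨m, rfl⟩ := Nat.exists_eq_succ_of_ne_zero hn
    rw [← sum_antidiagonal_choose_mul_rootedCount_mul_pow hn, Nat.sum_antidiagonal_succ',
      Nat.sum_antidiagonal_succ']
    simp [mul_rootedCount, add_comm]
  rw [split, ← abel]
  ring

/-! ### Branches -/

section Branch

variable {V : Type*} {G H : SimpleGraph V} {S S' P : Set V} {r w r' w' : V}

/-- The set `S` is a branch of `G` with root `r` and parent `w`: the only edge of `G` that leaves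
`S` is the edge from `r` to `w`. -/
structure IsBranch (G : SimpleGraph V) (S : Set V) (r w : V) : Prop where
  adj : G.Adj r w
  root_mem : r ∈ S
  parent_notMem : w ∉ S
  eq_of_adj : ∀ ⦃x y⦄, G.Adj x y → x ∈ S → y ∉ S → x = r ∧ y = w

namespace IsBranch

theorem compl (hb : IsBranch G S r w) : IsBranch G Sᶜ w r where
  adj := hb.adj.symm
  root_mem := hb.parent_notMem
  parent_notMem := not_not.2 hb.root_mem
  eq_of_adj _ _ hxy hx hy := (hb.eq_of_adj hxy.symm (not_not.1 hy) hx).symm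

theorem induce (hb : IsBranch G S r w) (hr : r ∈ P) (hw : w ∈ P) :
    IsBranch (G.induce P) (Subtype.val ⁻¹' S) ⟨r, hr⟩ ⟨w, hw⟩ where
  adj := hb.adj
  root_mem := hb.root_mem
  parent_notMem := hb.parent_notMem
  eq_of_adj x y hxy hx hy := by
    simpa only [Subtype.ext_iff] using hb.eq_of_adj (SimpleGraph.induce_adj.1 hxy) hx hy

theorem connected_induce (hb : IsBranch G S r w) (hG : G.Connected) :
    (G.induce S).Connected := by
  let root : S := ⟨r, hb.root_mem⟩
  let reached : Set V := {x | ∀ hx : x ∈ S, (G.induce S).Reachable root ⟨x, hx⟩}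
  have mem_reached (x : V) : x ∈ reached := by
    by_contra hx
    obtain ⟨p⟩ := hG.preconnected r x
    obtain ⟨d, -, hfst, hsnd⟩ := p.exists_boundary_dart reached (fun _ => .rfl) hx
    refine hsnd fun hsndS => ?_
    by_cases hfstS : d.fst ∈ S
    · exact (hfst hfstS).trans (SimpleGraph.Adj.reachable (SimpleGraph.induce_adj.2 d.adj))
    · obtain ⟨hroot, -⟩ := hb.eq_of_adj d.adj.symm hsndS hfstS
      simp only [hroot, root, SimpleGraph.Reachable.rfl]
  have : Nonempty S := ⟨root⟩
  exact ⟨fun x y => (mem_reached x x.2).symm.trans (mem_reached y y.2)⟩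

theorem isTree_induce (hb : IsBranch G S r w) (hG : G.IsTree) : (G.induce S).IsTree :=
  ⟨hb.connected_induce hG.connected, hG.isAcyclic.induce S⟩

theorem subset_or_disjoint (hb : IsBranch G S r w) (hP : (G.induce P).Preconnected)
    (hrw : r ∈ P → w ∉ P) : P ⊆ S ∨ Disjoint P S := by
  by_contra! ⟨hsub, hdisj⟩
  obtain ⟨y, hyP, hyS⟩ := Set.not_subset.1 hsub
  obtain ⟨x, hxP, hxS⟩ := Set.not_disjoint_iff.1 hdisj
  obtain ⟨p⟩ := hP ⟨x, hxP⟩ ⟨y, hyP⟩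
  obtain ⟨d, -, hfst, hsnd⟩ := p.exists_boundary_dart (Subtype.val ⁻¹' S) hxS hyS
  obtain ⟨hr, hw⟩ := hb.eq_of_adj (SimpleGraph.induce_adj.1 d.adj) hfst hsnd
  exact hrw (hr ▸ d.fst.2) (hw ▸ d.snd.2)

theorem nested_or_disjoint (hb : IsBranch G S r w) (hb' : IsBranch G S' r' w')
    (hG : G.Connected) : S ⊆ S' ∨ S' ⊆ S ∨ Disjoint S S' ∨ Sᶜ ⊆ S' := by
  by_cases hin : r' ∈ S ∧ w' ∈ S
  · have := hb'.subset_or_disjoint (hb.compl.connected_induce hG).preconnected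
      fun hr _ => hr hin.1
    rw [Set.disjoint_compl_left_iff_subset] at this
    tauto
  · have := hb'.subset_or_disjoint (hb.connected_induce hG).preconnected
      fun hr hw => hin ⟨hr, hw⟩
    tauto

theorem subset_of_root_eq (hb : IsBranch G S r w) (hb' : IsBranch G S' r w)
    (hG : G.Connected) : S ⊆ S' :=
  (hb'.subset_or_disjoint (hb.connected_induce hG).preconnected
    fun _ => hb.parent_notMem).resolve_right
      (Set.not_disjoint_iff.2 ⟨r, hb.root_mem, hb'.root_mem⟩)

theorem side_unique (hb : IsBranch G S r w) (hb' : IsBranch G S' r w) (hG : G.Connected) :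
    S = S' :=
  (hb.subset_of_root_eq hb' hG).antisymm (hb'.subset_of_root_eq hb hG)

theorem parent_eq_of_subset (hb : IsBranch G S r w) (hb' : IsBranch G S' r w')
    (hSS' : S ⊆ S') : w = w' :=
  (hb.eq_of_adj hb'.adj hb.root_mem fun h => hb'.parent_notMem (hSS' h)).2.symm

theorem le_of_induce_le (hb : IsBranch G S r w) (hb' : IsBranch H S r w)
    (hS : G.induce S ≤ H.induce S) (hSc : G.induce Sᶜ ≤ H.induce Sᶜ) : G ≤ H := by
  intro x y hxy
  by_cases hx : x ∈ S <;> by_cases hy : y ∈ S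
  · exact hS (v := ⟨x, hx⟩) (w := ⟨y, hy⟩) hxy
  · obtain ⟨rfl, rfl⟩ := hb.eq_of_adj hxy hx hy
    exact hb'.adj
  · obtain ⟨rfl, rfl⟩ := hb.eq_of_adj hxy.symm hy hx
    exact hb'.adj.symm
  · exact hSc (v := ⟨x, hx⟩) (w := ⟨y, hy⟩) hxy

theorem ext_induce (hb : IsBranch G S r w) (hb' : IsBranch H S r w)
    (hS : G.induce S = H.induce S) (hSc : G.induce Sᶜ = H.induce Sᶜ) : G = H :=
  (hb.le_of_induce_le hb' hS.le hSc.le).antisymm (hb'.le_of_induce_le hb hS.ge hSc.ge)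

end IsBranch

theorem isBranch_of_adj (hG : G.IsAcyclic) (hrw : G.Adj r w) :
    IsBranch G {u | (G.deleteEdges {s(r, w)}).Reachable r u} r w := by
  have hbridge : ¬ (G.deleteEdges {s(r, w)}).Reachable r w :=
    SimpleGraph.isBridge_iff.1 (SimpleGraph.isAcyclic_iff_forall_adj_isBridge.1 hG hrw)
  refine ⟨hrw, .rfl, hbridge, fun x y hxy hx hy => ?_⟩
  by_contra hne
  have hs : s(x, y) ≠ s(r, w) := by
    rw [Ne, Sym2.eq_iff]
    rintro (h | ⟨rfl, rfl⟩)
    exacts [hne h, hbridge hx]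
  exact hy (hx.trans (SimpleGraph.Adj.reachable (by simp [SimpleGraph.deleteEdges_adj, hxy, hs])))

theorem isTree_sum_sup_edge {α β : Type*} [Finite α] [Finite β] {A : SimpleGraph α}
    {B : SimpleGraph β} (hA : A.IsTree) (hB : B.IsTree) (a : α) (b : β) :
    (A.sum B ⊔ SimpleGraph.edge (Sum.inl a) (Sum.inr b)).IsTree := by
  classical
  have := Fintype.ofFinite α
  have := Fintype.ofFinite β
  rw [SimpleGraph.isTree_iff_connected_and_card] at hA hB ⊢
  refine ⟨hA.1.sum_sup_edge hB.1, ?_⟩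
  have card_sum := Nat.card_congr (SimpleGraph.edgeSetSumEquiv (G := A) (H := B))
  have card_sup := SimpleGraph.card_edgeFinset_sup_edge (A.sum B) (s := Sum.inl a) (t := Sum.inr b)
    (by simp) (by simp)
  simp only [Nat.card_eq_fintype_card, ← SimpleGraph.edgeFinset_card, Fintype.card_sum]
    at card_sum hA hB ⊢
  rw [card_sup, card_sum]
  omega

end Branch

section Glue

variable {V : Type*} {S : Set V} (A : SimpleGraph S) (B : SimpleGraph (Sᶜ : Set V)) (r : S)
  (w : (Sᶜ : Set V))

open Classical in
/-- The graph obtained from a graph on `S` and a graph on its complement by adding the edge from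
`r` to `w`. -/
noncomputable def glue : SimpleGraph V :=
  (A.sum B ⊔ SimpleGraph.edge (Sum.inl r) (Sum.inr w)).comap (Equiv.Set.sumCompl S).symm

theorem glue_adj_of_mem {x y : V} (hx : x ∈ S) (hy : y ∈ S) :
    (glue A B r w).Adj x y ↔ A.Adj ⟨x, hx⟩ ⟨y, hy⟩ := by
  simp [glue, Equiv.Set.sumCompl_symm_apply_of_mem, hx, hy, SimpleGraph.edge_adj]

theorem glue_adj_of_notMem {x y : V} (hx : x ∉ S) (hy : y ∉ S) :
    (glue A B r w).Adj x y ↔ B.Adj ⟨x, hx⟩ ⟨y, hy⟩ := by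
  simp [glue, Equiv.Set.sumCompl_symm_apply_of_notMem, hx, hy, SimpleGraph.edge_adj]

theorem glue_adj_of_mem_of_notMem {x y : V} (hx : x ∈ S) (hy : y ∉ S) :
    (glue A B r w).Adj x y ↔ x = r ∧ y = w := by
  simp [glue, Equiv.Set.sumCompl_symm_apply_of_mem, Equiv.Set.sumCompl_symm_apply_of_notMem, hx, hy,
    SimpleGraph.edge_adj, Subtype.ext_iff]

theorem induce_glue : (glue A B r w).induce S = A := by
  ext x y
  exact glue_adj_of_mem A B r w x.2 y.2

theorem induce_compl_glue : (glue A B r w).induce Sᶜ = B := by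
  ext x y
  exact glue_adj_of_notMem A B r w x.2 y.2

theorem isBranch_glue : IsBranch (glue A B r w) S r w where
  adj := (glue_adj_of_mem_of_notMem A B r w r.2 w.2).2 ⟨rfl, rfl⟩
  root_mem := r.2
  parent_notMem := w.2
  eq_of_adj _ _ hxy hx hy := (glue_adj_of_mem_of_notMem A B r w hx hy).1 hxy

variable {A B} in
theorem isTree_glue [Finite V] (hA : A.IsTree) (hB : B.IsTree) : (glue A B r w).IsTree := by
  classical
  exact (SimpleGraph.Iso.comap _ _).isTree_iff.2 (isTree_sum_sup_edge hA hB r w)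

end Glue

/-! ### Counting trees -/

section Trees

/-- The trees on the vertex set `V`. -/
noncomputable def trees (V : Type*) [Finite V] : Finset (SimpleGraph V) :=
  (Set.toFinite {G : SimpleGraph V | G.IsTree}).toFinset

@[simp]
theorem mem_trees {V : Type*} [Finite V] {G : SimpleGraph V} : G ∈ trees V ↔ G.IsTree := by
  simp [trees]

/-- The number of labelled trees on `n` vertices. -/
noncomputable def treeCount (n : ℕ) : ℕ :=
  #(trees (Fin n))

theorem card_trees (V : Type*) [Finite V] : #(trees V) = treeCount (Nat.card V) := by
  let e := Finite.equivFin V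
  refine card_equiv e.simpleGraph fun G => ?_
  rw [mem_trees, mem_trees]
  exact (SimpleGraph.Iso.comap e.symm G).symm.isTree_iff

open Classical in
theorem sum_trees_with_isBranch {V M : Type*} [Finite V] [AddCommMonoid M] {S : Set V} {r w : V}
    (hr : r ∈ S) (hw : w ∉ S) (f : SimpleGraph S → SimpleGraph (Sᶜ : Set V) → M) :
    ∑ G ∈ trees V with IsBranch G S r w, f (G.induce S) (G.induce Sᶜ) =
      ∑ A ∈ trees S, ∑ B ∈ trees (Sᶜ : Set V), f A B := by
  rw [← sum_product']
  refine sum_bij' (fun G _ => (G.induce S, G.induce Sᶜ))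
    (fun p _ => glue p.1 p.2 ⟨r, hr⟩ ⟨w, hw⟩) ?_ ?_ ?_ ?_ fun _ _ => rfl
  · intro G hG
    obtain ⟨hG, hb⟩ := mem_filter.1 hG
    exact mem_product.2 ⟨mem_trees.2 (hb.isTree_induce (mem_trees.1 hG)),
      mem_trees.2 (hb.compl.isTree_induce (mem_trees.1 hG))⟩
  · intro p hp
    obtain ⟨hA, hB⟩ := mem_product.1 hp
    exact mem_filter.2 ⟨mem_trees.2 (isTree_glue _ _ (mem_trees.1 hA) (mem_trees.1 hB)),
      isBranch_glue _ _ _ _⟩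
  · intro G hG
    exact (isBranch_glue _ _ ⟨r, hr⟩ ⟨w, hw⟩).ext_induce (mem_filter.1 hG).2
      (induce_glue _ _ _ _) (induce_compl_glue _ _ _ _)
  · intro p _
    exact Prod.ext (induce_glue _ _ _ _) (induce_compl_glue _ _ _ _)

end Trees

section SmallBranches

/-- The branches `(S, r, w)` of `G` with at most `K` vertices, with root `r` and parent `w`. -/
noncomputable def smallBranches {V : Type*} [Finite V] (K : ℕ) (G : SimpleGraph V) :
    Finset (Finset V × V × V) :=
  (Set.toFinite {c : Finset V × V × V | IsBranch G c.1 c.2.1 c.2.2 ∧ #c.1 ≤ K}).toFinset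

variable {V : Type*}

theorem mem_smallBranches [Finite V] {K : ℕ} {G : SimpleGraph V} {c : Finset V × V × V} :
    c ∈ smallBranches K G ↔ IsBranch G c.1 c.2.1 c.2.2 ∧ #c.1 ≤ K := by
  simp [smallBranches]

variable [Fintype V]

theorem sum_card_le_apply_card (K : ℕ) (g : ℕ → ℕ) :
    ∑ S : Finset V with #S ≤ K, g #S =
      ∑ k ∈ range (K + 1), (Fintype.card V).choose k * g k := by
  rw [← sum_fiberwise_of_maps_to (g := card) (t := range (K + 1)) (by simp)]
  refine sum_congr rfl fun k hk => ?_
  have filter_card_eq : ({S : Finset V | #S ≤ K} : Finset _).filter (#· = k) =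
      powersetCard k univ := by
    have := mem_range_succ_iff.1 hk
    grind
  rw [filter_card_eq, sum_congr rfl fun S hS => congrArg g (mem_powersetCard.1 hS).2, sum_const,
    card_powersetCard, card_univ, smul_eq_mul]

theorem sum_trees_sum_smallBranches {M : Type*} [AddCommMonoid M] (K : ℕ)
    (f : ∀ S : Finset V, SimpleGraph ((S : Set V)ᶜ : Set V) → M) :
    ∑ G ∈ trees V, ∑ c ∈ smallBranches K G, f c.1 (G.induce (c.1 : Set V)ᶜ) =
      ∑ S : Finset V with #S ≤ K,
        (#S * (Fintype.card V - #S) * treeCount #S) •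
          ∑ B ∈ trees ((S : Set V)ᶜ : Set V), f S B := by
  classical
  rw [sum_comm' (t' := ({c | #c.1 ≤ K ∧ c.2.1 ∈ c.1 ∧ c.2.2 ∉ c.1} : Finset (Finset V × V × V)))
    (s' := fun c => {G ∈ trees V | IsBranch G c.1 c.2.1 c.2.2}) fun G c => ?_]
  · rw [sum_finset_product' _ ({S : Finset V | #S ≤ K} : Finset _) (fun S => S ×ˢ Sᶜ)
      (fun c => by simp)
      (f := fun S e => ∑ G ∈ trees V with IsBranch G S e.1 e.2, f S (G.induce (S : Set V)ᶜ))]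
    refine sum_congr rfl fun S _ => ?_
    have sum_eq : ∀ e ∈ S ×ˢ Sᶜ,
        ∑ G ∈ trees V with IsBranch G S e.1 e.2, f S (G.induce (S : Set V)ᶜ) =
          treeCount #S • ∑ B ∈ trees ((S : Set V)ᶜ : Set V), f S B := by
      intro e he
      obtain ⟨hr, hw⟩ := mem_product.1 he
      rw [sum_trees_with_isBranch (mem_coe.2 hr) (by simpa using hw) fun _ B => f S B, sum_const,
        card_trees, Nat.card_coe_set_eq, Set.ncard_coe_finset]
    rw [sum_congr rfl sum_eq, sum_const, card_product, card_compl, mul_smul _ (treeCount _)]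
  · simp only [mem_smallBranches, mem_filter, mem_univ, true_and]
    exact ⟨fun ⟨hG, hb, hK⟩ => ⟨⟨hG, hb⟩, hK, hb.root_mem, hb.parent_notMem⟩,
      fun ⟨⟨hG, hb⟩, hK, _⟩ => ⟨hG, hb, hK⟩⟩

theorem sum_trees_sum_smallBranches_of_card (K : ℕ)
    {f : ∀ S : Finset V, SimpleGraph ((S : Set V)ᶜ : Set V) → ℕ} {g : ℕ → ℕ}
    (hfg : ∀ S : Finset V, ∑ B ∈ trees ((S : Set V)ᶜ : Set V), f S B = g (Fintype.card V - #S)) :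
    ∑ G ∈ trees V, ∑ c ∈ smallBranches K G, f c.1 (G.induce (c.1 : Set V)ᶜ) =
      ∑ k ∈ range (K + 1), (Fintype.card V).choose k *
        (k * treeCount k * ((Fintype.card V - k) * g (Fintype.card V - k))) := by
  rw [sum_trees_sum_smallBranches, ← sum_card_le_apply_card K fun k =>
    k * treeCount k * ((Fintype.card V - k) * g (Fintype.card V - k))]
  refine sum_congr rfl fun S _ => ?_
  rw [hfg, smul_eq_mul]
  ring

theorem natCard_coe_compl (S : Finset V) :
    Nat.card ((S : Set V)ᶜ : Set V) = Fintype.card V - #S := by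
  rw [Nat.card_coe_set_eq, Set.ncard_compl, Set.ncard_coe_finset, Nat.card_eq_fintype_card]

theorem card_smallBranches_card_add_two {G : SimpleGraph V} (hG : G.IsTree) :
    #(smallBranches (Fintype.card V) G) + 2 = 2 * Fintype.card V := by
  classical
  have card_eq : #(smallBranches (Fintype.card V) G) = #(univ : Finset G.Dart) := by
    refine card_bij (fun c hc => ⟨c.2, (mem_smallBranches.1 hc).1.adj⟩) (fun _ _ => mem_univ _)
      ?_ ?_
    · intro c hc c' hc' heq
      obtain ⟨S, e⟩ := c
      obtain ⟨S', e'⟩ := c'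
      obtain rfl : e = e' := congrArg SimpleGraph.Dart.toProd heq
      have hS := (mem_smallBranches.1 hc).1.side_unique (mem_smallBranches.1 hc').1 hG.connected
      exact Prod.ext (coe_injective hS) rfl
    · intro d _
      let S := (Set.toFinite {u | (G.deleteEdges {s(d.fst, d.snd)}).Reachable d.fst u}).toFinset
      refine ⟨(S, d.toProd), mem_smallBranches.2 ⟨?_, card_le_univ _⟩, rfl⟩
      rw [Set.Finite.coe_toFinset]
      exact isBranch_of_adj hG.isAcyclic d.adj
  rw [card_eq, card_univ, SimpleGraph.dart_card_eq_twice_card_edges, ← hG.card_edgeFinset]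
  ring

/-- Count the pairs of a tree on `n` vertices and an oriented edge: each tree has `2 (n - 1)` of
them, and cutting the edge leaves two rooted trees. -/
theorem sum_choose_mul_treeCount (n : ℕ) :
    ∑ k ∈ range (n + 1), n.choose k * (k * treeCount k * ((n - k) * treeCount (n - k))) +
      2 * treeCount n = 2 * n * treeCount n := by
  have double_count := sum_trees_sum_smallBranches_of_card (V := Fin n) n (f := fun _ _ => 1)
    (g := treeCount) fun S => by
      rw [← card_eq_sum_ones, card_trees, natCard_coe_compl]
  have card_add_two : ∀ G ∈ trees (Fin n), #(smallBranches n G) + 2 = 2 * n := fun G hG => by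
    simpa using card_smallBranches_card_add_two (mem_trees.1 hG)
  simp only [← card_eq_sum_ones, Fintype.card_fin] at double_count
  rw [← double_count, mul_comm 2 (treeCount n)]
  have := sum_congr rfl card_add_two
  rwa [sum_add_distrib, sum_const, sum_const, smul_eq_mul, smul_eq_mul, mul_comm (#_) (2 * n)]
    at this

theorem treeCount_one : treeCount 1 = 1 := by
  have isTree (G : SimpleGraph (Fin 1)) : G.IsTree := .of_subsingleton
  rw [treeCount, card_eq_one]
  exact ⟨⊥, by ext G; simp [isTree, Subsingleton.elim G ⊥]⟩

/-- **Cayley's formula**, counting rooted trees. -/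
theorem mul_treeCount (n : ℕ) : n * treeCount n = rootedCount n := by
  induction n using Nat.strong_induction_on with | _ n ih =>
  obtain rfl | rfl | hn : n = 0 ∨ n = 1 ∨ 2 ≤ n := by omega
  · simp [rootedCount]
  · simp [rootedCount, treeCount_one]
  have summand_eq : ∀ k ∈ range (n + 1),
      n.choose k * (k * treeCount k * ((n - k) * treeCount (n - k))) =
        n.choose k * (rootedCount k * rootedCount (n - k)) := by
    intro k hk
    obtain rfl | rfl | hk : k = 0 ∨ k = n ∨ 0 < k ∧ k < n := by have := mem_range.1 hk; omega
    · simp [rootedCount]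
    · simp [rootedCount]
    · rw [ih k hk.2, ih (n - k) (by omega)]
  have double_count := sum_choose_mul_treeCount n
  have convolution := sum_antidiagonal_choose_mul_rootedCount_mul_rootedCount (n := n) (by omega)
  rw [sum_congr rfl summand_eq] at double_count
  rw [Nat.sum_antidiagonal_eq_sum_range_succ
    (fun i j => n.choose i * (rootedCount i * rootedCount j)),
    ← mul_rootedCount (by omega)] at convolution
  zify at double_count convolution ⊢
  refine mul_left_cancel₀ (show (2 * n - 2 : ℤ) ≠ 0 by omega) ?_
  linear_combination convolution - n * double_count

end SmallBranches

/-! ### The first two moments of the number of small branches -/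

/-- The number of pairs of a tree on `n` labelled vertices and a branch of it with at most `K`
vertices: such a branch is a rooted tree, and so is the rest of the tree. -/
def branchTotal (K n : ℕ) : ℕ :=
  ∑ k ∈ range (K + 1), n.choose k * (rootedCount k * rootedCount (n - k))

section Moments

variable {V : Type*} [Fintype V]

theorem sum_card_smallBranches (K : ℕ) :
    ∑ G ∈ trees V, #(smallBranches K G) = branchTotal K (Fintype.card V) := by
  simp only [card_eq_sum_ones]
  rw [sum_trees_sum_smallBranches_of_card K (f := fun _ _ => 1) (g := treeCount) fun S => by
    rw [← card_eq_sum_ones, card_trees, natCard_coe_compl]]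
  simp only [mul_treeCount, branchTotal]

theorem sum_sum_card_smallBranches_induce (K : ℕ) :
    ∑ G ∈ trees V, ∑ c ∈ smallBranches K G, #(smallBranches K (G.induce (c.1 : Set V)ᶜ)) =
      ∑ k ∈ range (K + 1), (Fintype.card V).choose k *
        (rootedCount k * ((Fintype.card V - k) * branchTotal K (Fintype.card V - k))) := by
  classical
  rw [sum_trees_sum_smallBranches_of_card K (f := fun _ B => #(smallBranches K B))
    (g := branchTotal K) fun S => by
      rw [sum_card_smallBranches, ← Nat.card_eq_fintype_card, natCard_coe_compl]]
  simp only [mul_treeCount]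

variable {K : ℕ} {G : SimpleGraph V} {c c' : Finset V × V × V}

theorem subset_or_subset_or_disjoint_of_mem_smallBranches (hK : 2 * K < Fintype.card V)
    (hG : G.Connected) (hc : c ∈ smallBranches K G) (hc' : c' ∈ smallBranches K G) :
    c.1 ⊆ c'.1 ∨ c'.1 ⊆ c.1 ∨ Disjoint c.1 c'.1 := by
  classical
  rw [mem_smallBranches] at hc hc'
  have not_compl_subset : ¬ (c.1 : Set V)ᶜ ⊆ c'.1 := by
    intro h
    rw [← coe_compl, coe_subset] at h
    have := card_le_card h
    rw [card_compl] at this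
    omega
  simpa [not_compl_subset] using hc.1.nested_or_disjoint hc'.1 hG

theorem injOn_root_smallBranches (hK : 2 * K < Fintype.card V) (hG : G.Connected) :
    Set.InjOn (fun c : Finset V × V × V => c.2.1) (smallBranches K G) := by
  have eq_of_subset : ∀ {c c'}, c ∈ smallBranches K G → c' ∈ smallBranches K G → c.2.1 = c'.2.1 →
      c.1 ⊆ c'.1 → c = c' := by
    rintro ⟨S, r, w⟩ ⟨S', r', w'⟩ hc hc' (rfl : r = r') hSS'
    rw [mem_smallBranches] at hc hc'
    obtain rfl : w = w' := hc.1.parent_eq_of_subset hc'.1 (coe_subset.2 hSS')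
    exact Prod.ext (coe_injective (hc.1.side_unique hc'.1 hG)) rfl
  intro c hc c' hc' (hroot : c.2.1 = c'.2.1)
  obtain h | h | h := subset_or_subset_or_disjoint_of_mem_smallBranches hK hG hc hc'
  · exact eq_of_subset hc hc' hroot h
  · exact (eq_of_subset hc' hc hroot.symm h).symm
  · have root_mem' : c.2.1 ∈ c'.1 := hroot ▸ (mem_smallBranches.1 hc').1.root_mem
    exact (disjoint_left.1 h (mem_smallBranches.1 hc).1.root_mem root_mem').elim

theorem card_smallBranches_le (hK : 2 * K < Fintype.card V) (hG : G.Connected) :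
    #(smallBranches K G) ≤ Fintype.card V :=
  card_le_card_of_injOn _ (fun _ _ => mem_univ _) (injOn_root_smallBranches hK hG)

theorem card_smallBranches_subset_le [DecidableEq V] (hK : 2 * K < Fintype.card V)
    (hG : G.Connected) (S : Finset V) : #{c ∈ smallBranches K G | c.1 ⊆ S} ≤ #S := by
  refine card_le_card_of_injOn (fun c => c.2.1) (fun c hc => ?_)
    ((injOn_root_smallBranches hK hG).mono (coe_subset.2 (filter_subset _ _)))
  obtain ⟨hc, hS⟩ := mem_filter.1 hc
  exact hS (mem_smallBranches.1 hc).1.root_mem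

theorem parent_notMem_of_disjoint (hK : 2 * K < Fintype.card V) (hG : G.Connected)
    (hc : c ∈ smallBranches K G) (hc' : c' ∈ smallBranches K G) (hdisj : Disjoint c.1 c'.1) :
    c'.2.2 ∉ c.1 := by
  classical
  rw [mem_smallBranches] at hc hc'
  intro hw
  obtain ⟨hr, hw⟩ := hc.1.eq_of_adj hc'.1.adj.symm hw (disjoint_right.1 hdisj hc'.1.root_mem)
  have hb := hc.1.compl
  rw [← hr, ← hw] at hb
  have hS := hb.side_unique hc'.1 hG
  rw [← coe_compl, coe_inj] at hS
  have := card_compl c.1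
  rw [hS] at this
  omega

theorem card_smallBranches_disjoint_le [DecidableEq V] (hK : 2 * K < Fintype.card V)
    (hG : G.Connected) (hc : c ∈ smallBranches K G) :
    #{c' ∈ smallBranches K G | Disjoint c.1 c'.1} ≤
      #(smallBranches K (G.induce (c.1 : Set V)ᶜ)) := by
  classical
  refine card_le_card_of_surjOn
    (fun d => (d.1.map (.subtype _), (d.2.1 : V), (d.2.2 : V))) fun c' hc' => ?_
  obtain ⟨hc', hdisj⟩ := mem_filter.1 hc'
  obtain ⟨hb, hcard⟩ := mem_smallBranches.1 hc'
  have hS' : ∀ x ∈ c'.1, x ∈ (c.1 : Set V)ᶜ := fun x hx => by simpa using disjoint_right.1 hdisj hx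
  refine ⟨(c'.1.subtype _, ⟨c'.2.1, hS' _ hb.root_mem⟩,
    ⟨c'.2.2, parent_notMem_of_disjoint hK hG hc hc' hdisj⟩), mem_coe.2 (mem_smallBranches.2 ?_),
    Prod.ext (subtype_map_of_mem hS') rfl⟩
  refine ⟨by convert! hb.induce _ _; ext; simp, ?_⟩
  rw [card_subtype]
  exact (card_filter_le _ _).trans hcard

theorem card_smallBranches_sq_le (hK : 2 * K < Fintype.card V) (hG : G.Connected) :
    #(smallBranches K G) ^ 2 ≤
      ∑ c ∈ smallBranches K G, #(smallBranches K (G.induce (c.1 : Set V)ᶜ)) +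
        2 * K * #(smallBranches K G) := by
  classical
  set B := smallBranches K G
  have nested : ∑ c ∈ B, #{c' ∈ B | c'.1 ⊆ c.1} ≤ K * #B := by
    rw [mul_comm, ← smul_eq_mul]
    exact sum_le_card_nsmul _ _ _ fun c hc =>
      (card_smallBranches_subset_le hK hG c.1).trans (mem_smallBranches.1 hc).2
  have nested' : ∑ c ∈ B, #{c' ∈ B | c.1 ⊆ c'.1} ≤ K * #B := by
    simp only [card_filter] at nested ⊢
    rwa [sum_comm]
  have cover : ∀ c ∈ B, #B ≤ #{c' ∈ B | Disjoint c.1 c'.1} +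
      (#{c' ∈ B | c'.1 ⊆ c.1} + #{c' ∈ B | c.1 ⊆ c'.1}) := by
    intro c hc
    refine (card_le_card fun c' hc' => ?_).trans ((card_union_le _ _).trans
      (Nat.add_le_add_left (card_union_le _ _) _))
    have := subset_or_subset_or_disjoint_of_mem_smallBranches hK hG hc hc'
    simp only [mem_union, mem_filter]
    tauto
  calc #B ^ 2 = ∑ _c ∈ B, #B := by rw [sum_const, smul_eq_mul, sq]
    _ ≤ ∑ c ∈ B, (#(smallBranches K (G.induce (c.1 : Set V)ᶜ)) +
          (#{c' ∈ B | c'.1 ⊆ c.1} + #{c' ∈ B | c.1 ⊆ c'.1})) := sum_le_sum fun c hc =>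
        (cover c hc).trans (Nat.add_le_add_right (card_smallBranches_disjoint_le hK hG hc) _)
    _ ≤ _ := by
        rw [sum_add_distrib, sum_add_distrib, two_mul, add_mul]
        exact Nat.add_le_add_left (Nat.add_le_add nested nested') _

theorem sum_card_smallBranches_sq_le (hK : 2 * K < Fintype.card V) :
    ∑ G ∈ trees V, #(smallBranches K G) ^ 2 ≤
      ∑ k ∈ range (K + 1), (Fintype.card V).choose k *
        (rootedCount k * ((Fintype.card V - k) * branchTotal K (Fintype.card V - k))) +
      2 * K * branchTotal K (Fintype.card V) := by
  rw [← sum_sum_card_smallBranches_induce, ← sum_card_smallBranches, mul_sum, ← sum_add_distrib]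
  exact sum_le_sum fun G hG => card_smallBranches_sq_le hK (mem_trees.1 hG).connected

end Moments

/-! ### The Borel distribution -/

/-- The Borel distribution `(k / e) ^ k / (k * k!)` on the positive integers. It is `0` at `k = 0`,
by `x / 0 = 0`. -/
noncomputable def borel (k : ℕ) : ℝ :=
  ((k : ℝ) / Real.exp 1) ^ k / ((k : ℝ) * (k.factorial : ℝ))

theorem borel_zero : borel 0 = 0 := by simp [borel]

theorem borel_pos {k : ℕ} (hk : k ≠ 0) : 0 < borel k := by
  unfold borel
  positivity

theorem borel_eq_rootedCount_mul_exp_div (k : ℕ) :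
    borel k = rootedCount k * Real.exp (-k) / k.factorial := by
  obtain rfl | hk := eq_or_ne k 0
  · simp [borel, rootedCount]
  · have cast_mul : (k : ℝ) * rootedCount k = k ^ k := mod_cast mul_rootedCount hk
    rw [borel, div_pow, ← Real.exp_nat_mul, mul_one, Real.exp_neg, ← cast_mul]
    field_simp

theorem h_eq_one_sub_sum_range (K : ℕ) : h K = 1 - ∑ k ∈ range (K + 1), borel k := by
  rw [sum_range_eq_add_Ico _ K.succ_pos, borel_zero, zero_add]
  rfl

theorem h_succ (K : ℕ) : h (K + 1) = h K - borel (K + 1) := by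
  rw [h_eq_one_sub_sum_range, h_eq_one_sub_sum_range, sum_range_succ _ (K + 1), sub_sub]

theorem h_antitone : Antitone h :=
  antitone_nat_of_succ_le fun K => by
    rw [h_succ]
    exact sub_le_self _ (borel_pos K.succ_ne_zero).le

theorem h_sub_h_add (n m : ℕ) : h n - h (n + m) = ∑ j ∈ range m, borel (n + j + 1) := by
  have telescope := sum_range_sub' (fun j => h (n + j)) m
  rw [add_zero] at telescope
  rw [← telescope]
  exact sum_congr rfl fun j _ => by rw [← add_assoc, h_succ, sub_sub_cancel]

/-- The weights `(m / e) ^ m / m!`, which form the renewal sequence of the Borel distribution. -/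
noncomputable def renewal (m : ℕ) : ℝ :=
  ((m : ℝ) / Real.exp 1) ^ m / m.factorial

theorem renewal_pos (m : ℕ) : 0 < renewal m := by
  obtain rfl | hm := eq_or_ne m 0
  · simp [renewal]
  · unfold renewal
    positivity

theorem borel_eq_renewal_div (k : ℕ) : borel k = renewal k / k := by
  rw [borel, renewal, div_div, mul_comm (k : ℝ)]

theorem renewal_eq_pow_mul_exp_div (m : ℕ) : renewal m = m ^ m * Real.exp (-m) / m.factorial := by
  rw [renewal, div_pow, ← Real.exp_nat_mul, mul_one, Real.exp_neg, div_eq_mul_inv (_ ^ m)]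

/-- The renewal equation is Abel's identity divided by `n! e ^ n`. -/
theorem sum_antidiagonal_borel_mul_renewal {n : ℕ} (hn : n ≠ 0) :
    ∑ p ∈ antidiagonal n, borel p.1 * renewal p.2 = renewal n := by
  have abel : ∑ p ∈ antidiagonal n, (n.choose p.1 * (rootedCount p.1 * p.2 ^ p.2) : ℝ) = n ^ n :=
    mod_cast sum_antidiagonal_choose_mul_rootedCount_mul_pow hn
  rw [renewal_eq_pow_mul_exp_div, ← abel, sum_mul, sum_div]
  refine sum_congr rfl fun p hp => ?_
  obtain rfl := HasAntidiagonal.mem_antidiagonal.1 hp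
  rw [borel_eq_rootedCount_mul_exp_div, renewal_eq_pow_mul_exp_div, Nat.cast_add_choose,
    Nat.cast_add, neg_add, Real.exp_add]
  field_simp

section PowerSeries

open PowerSeries

theorem one_sub_mk_borel_mul_mk_renewal :
    (1 - PowerSeries.mk borel) * PowerSeries.mk renewal = 1 := by
  ext n
  rw [sub_mul, one_mul, map_sub, coeff_mul, coeff_one]
  simp only [coeff_mk]
  obtain rfl | hn := eq_or_ne n 0
  · simp [borel_zero, renewal]
  · rw [sum_antidiagonal_borel_mul_renewal hn, sub_self, if_neg hn]

theorem mk_h_mul_one_sub_X : PowerSeries.mk h * (1 - X) = 1 - PowerSeries.mk borel := by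
  ext n
  rw [mul_sub, mul_one, map_sub, map_sub, coeff_one]
  obtain _ | n := n
  · simp [h_eq_one_sub_sum_range, borel_zero]
  · simp [coeff_succ_mul_X, h_succ]

/-- In terms of power series, `h = (1 - borel) / (1 - X)` and `renewal = 1 / (1 - borel)`. -/
theorem sum_antidiagonal_renewal_mul_h (n : ℕ) :
    ∑ p ∈ antidiagonal n, renewal p.1 * h p.2 = 1 := by
  have product_eq : PowerSeries.mk renewal * PowerSeries.mk h = PowerSeries.mk 1 := by
    calc PowerSeries.mk renewal * PowerSeries.mk h
        = PowerSeries.mk 1 * ((PowerSeries.mk h * (1 - X)) * PowerSeries.mk renewal) := by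
          linear_combination (-(PowerSeries.mk renewal * PowerSeries.mk h)) *
            mk_one_mul_one_sub_eq_one ℝ
      _ = PowerSeries.mk 1 := by
          rw [mk_h_mul_one_sub_X, one_sub_mk_borel_mul_mk_renewal, mul_one]
  simpa [coeff_mul] using congrArg (coeff n) product_eq

end PowerSeries

/-! ### Convergence of the moments -/

/-- The expected number of branches with `k` vertices of a uniformly random tree on `n` labelled
vertices, divided by `n`. -/
noncomputable def branchRatio (k n : ℕ) : ℝ :=
  n.choose k * rootedCount k * rootedCount (n - k) / rootedCount n

/-- The expected number of branches with at most `K` vertices of a uniformly random tree on `n`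
labelled vertices, divided by `n`. -/
noncomputable def branchDensity (K n : ℕ) : ℝ :=
  branchTotal K n / rootedCount n

theorem branchDensity_eq_sum (K n : ℕ) :
    branchDensity K n = ∑ k ∈ range (K + 1), branchRatio k n := by
  simp only [branchDensity, branchTotal, branchRatio, Nat.cast_sum, Nat.cast_mul, sum_div,
    mul_assoc]

theorem tendsto_one_add_neg_div (k : ℕ) :
    Tendsto (fun n : ℕ => 1 + (-(k : ℝ)) / n) atTop (𝓝 1) := by
  simpa using (tendsto_const_div_atTop_nhds_zero_nat (-(k : ℝ))).const_add 1

theorem tendsto_pow_mul_rootedCount_sub_div (k : ℕ) :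
    Tendsto (fun n : ℕ => (n : ℝ) ^ k * rootedCount (n - k) / rootedCount n) atTop
      (𝓝 (Real.exp (-k))) := by
  have limit := (Real.tendsto_one_add_div_pow_exp (-(k : ℝ))).mul
    (((tendsto_one_add_neg_div k).pow (k + 1)).inv₀ (by simp))
  rw [one_pow, inv_one, mul_one] at limit
  refine limit.congr' ?_
  filter_upwards [eventually_gt_atTop k] with n hn
  obtain ⟨m, rfl⟩ := Nat.exists_eq_add_of_le' hn
  have base_eq : 1 + -(k : ℝ) / (m + (k + 1) : ℕ) = (m + 1) / (m + (k + 1) : ℕ) := by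
    push_cast
    field_simp
    ring
  rw [base_eq, show m + k.succ - k = m + 1 by omega, pow_add, mul_inv_cancel_right₀ (by positivity),
    ← add_assoc, rootedCount_succ, rootedCount_succ, div_pow]
  push_cast
  field_simp
  rw [pow_add]

theorem tendsto_choose_div_pow (k : ℕ) :
    Tendsto (fun n : ℕ => (n.choose k : ℝ) / n ^ k) atTop (𝓝 (1 / k.factorial)) := by
  have mul_inv : Tendsto (fun n : ℕ => (n : ℝ) * (n : ℝ)⁻¹) atTop (𝓝 1) :=
    tendsto_const_nhds.congr' <| (eventually_ne_atTop 0).mono fun n hn =>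
      (mul_inv_cancel₀ (Nat.cast_ne_zero.2 hn)).symm
  simpa [div_eq_mul_inv] using ProbabilityTheory.tendsto_choose_mul_pow_atTop k mul_inv

theorem tendsto_branchRatio (k : ℕ) : Tendsto (branchRatio k) atTop (𝓝 (borel k)) := by
  have limit := ((tendsto_choose_div_pow k).mul (tendsto_pow_mul_rootedCount_sub_div k)).const_mul
    (rootedCount k : ℝ)
  rw [borel_eq_rootedCount_mul_exp_div, show rootedCount k * Real.exp (-k) / k.factorial =
    rootedCount k * (1 / k.factorial * Real.exp (-k)) by ring]
  refine limit.congr' ?_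
  filter_upwards [eventually_ne_atTop 0] with n hn
  rw [branchRatio]
  field_simp

theorem tendsto_branchDensity (K : ℕ) : Tendsto (branchDensity K) atTop (𝓝 (1 - h K)) := by
  rw [h_eq_one_sub_sum_range, sub_sub_cancel, funext (branchDensity_eq_sum K)]
  exact tendsto_finsetSum _ fun k _ => tendsto_branchRatio k

/-- An upper bound for the mean square of the number of branches with at most `K` vertices of a
uniformly random tree on `n` labelled vertices, divided by `n ^ 2`. -/
noncomputable def secondMomentBound (K n : ℕ) : ℝ :=
  ∑ k ∈ range (K + 1), branchRatio k n * branchDensity K (n - k) +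
    (2 * K : ℝ) / n * branchDensity K n

theorem tendsto_secondMomentBound (K : ℕ) :
    Tendsto (secondMomentBound K) atTop (𝓝 ((1 - h K) ^ 2)) := by
  have disjoint_pairs : Tendsto
      (fun n => ∑ k ∈ range (K + 1), branchRatio k n * branchDensity K (n - k)) atTop
      (𝓝 (∑ k ∈ range (K + 1), borel k * (1 - h K))) :=
    tendsto_finsetSum _ fun k _ => (tendsto_branchRatio k).mul
      ((tendsto_branchDensity K).comp (tendsto_sub_atTop_nat k))
  have nested_pairs := (tendsto_const_div_atTop_nhds_zero_nat (2 * K : ℝ)).mul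
    (tendsto_branchDensity K)
  rw [← sum_mul,
    show ∑ k ∈ range (K + 1), borel k = 1 - h K by rw [h_eq_one_sub_sum_range, sub_sub_cancel]]
    at disjoint_pairs
  have limit := disjoint_pairs.add nested_pairs
  rwa [zero_mul, add_zero, ← sq] at limit

/-! ### The order of magnitude of `h` -/

theorem branchTotal_le_rootedCount {K n : ℕ} (hn : 2 * K < n) :
    branchTotal K n ≤ rootedCount n := by
  calc branchTotal K n = ∑ G ∈ trees (Fin n), #(smallBranches K G) := by
        rw [sum_card_smallBranches, Fintype.card_fin]
    _ ≤ ∑ _G ∈ trees (Fin n), n := sum_le_sum fun G hG => by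
        simpa using card_smallBranches_le (by simpa using hn) (mem_trees.1 hG).connected
    _ = rootedCount n := by
        rw [sum_const, smul_eq_mul, card_trees, Nat.card_fin, mul_comm, mul_treeCount]

theorem h_nonneg (K : ℕ) : 0 ≤ h K := by
  have density_le_one : 1 - h K ≤ 1 := by
    refine le_of_tendsto (tendsto_branchDensity K) ?_
    filter_upwards [eventually_gt_atTop (2 * K)] with n hn
    exact div_le_one_of_le₀ (mod_cast branchTotal_le_rootedCount hn) (Nat.cast_nonneg _)
  linarith

theorem h_pos (K : ℕ) : 0 < h K := by
  linarith [h_succ K, h_nonneg (K + 1), borel_pos K.succ_ne_zero]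

theorem renewal_eq_one_div_stirlingSeq {m : ℕ} (hm : m ≠ 0) :
    renewal m = 1 / (√(2 * m) * Stirling.stirlingSeq m) := by
  rw [renewal, Stirling.stirlingSeq]
  field_simp

theorem one_div_sqrt_le_renewal {m : ℕ} (hm : m ≠ 0) : 1 / (Real.exp 1 * √m) ≤ renewal m := by
  have stirlingSeq_le : Stirling.stirlingSeq m ≤ Real.exp 1 / √2 := by
    obtain ⟨k, rfl⟩ := Nat.exists_eq_succ_of_ne_zero hm
    simpa [Stirling.stirlingSeq_one] using Stirling.stirlingSeq'_antitone k.zero_le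
  have stirlingSeq_pos : 0 < Stirling.stirlingSeq m := by
    unfold Stirling.stirlingSeq
    positivity
  rw [renewal_eq_one_div_stirlingSeq hm]
  refine one_div_le_one_div_of_le (by positivity) ?_
  calc √(2 * m) * Stirling.stirlingSeq m ≤ √(2 * m) * (Real.exp 1 / √2) := by gcongr
    _ = Real.exp 1 * √m := by
        rw [Real.sqrt_mul zero_le_two]
        field_simp

theorem sqrt_div_exp_le_sum_renewal (n : ℕ) :
    √n / Real.exp 1 ≤ ∑ j ∈ range (n + 1), renewal j := by
  calc √n / Real.exp 1 = ∑ _j ∈ range n, 1 / (Real.exp 1 * √n) := by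
        rw [sum_const, card_range, nsmul_eq_mul, mul_one_div, mul_comm (Real.exp 1), ← div_div,
          Real.div_sqrt]
    _ ≤ ∑ j ∈ range n, renewal (j + 1) := sum_le_sum fun j hj => by
        refine le_trans ?_ (one_div_sqrt_le_renewal j.succ_ne_zero)
        have := mem_range.1 hj
        gcongr
        exact this
    _ ≤ ∑ j ∈ range (n + 1), renewal j := by
        rw [sum_range_succ']
        exact le_add_of_nonneg_right (renewal_pos 0).le

theorem h_le_exp_one_mul {n : ℕ} (hn : n ≠ 0) : h n ≤ Real.exp 1 * (1 / √n) := by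
  have sum_mul_h_le : (∑ j ∈ range (n + 1), renewal j) * h n ≤ 1 := by
    rw [← sum_antidiagonal_renewal_mul_h n, Nat.sum_antidiagonal_eq_sum_range_succ_mk, sum_mul]
    exact sum_le_sum fun j _ =>
      mul_le_mul_of_nonneg_left (h_antitone (Nat.sub_le _ _)) (renewal_pos j).le
  have sqrt_mul_h_le : √n / Real.exp 1 * h n ≤ 1 :=
    (mul_le_mul_of_nonneg_right (sqrt_div_exp_le_sum_renewal n) (h_nonneg n)).trans sum_mul_h_le
  have sqrt_pos : 0 < √(n : ℝ) := by positivity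
  rw [div_mul_eq_mul_div, div_le_one (Real.exp_pos 1)] at sqrt_mul_h_le
  rwa [mul_one_div, le_div_iff₀' sqrt_pos]

theorem one_div_le_borel {k m : ℕ} (hk : k ≠ 0) (hkm : k ≤ m) :
    1 / (Real.exp 1 * √m * m) ≤ borel k := by
  rw [borel_eq_renewal_div]
  calc 1 / (Real.exp 1 * √m * m) ≤ 1 / (Real.exp 1 * √k * k) := by gcongr
    _ = 1 / (Real.exp 1 * √k) / k := by rw [div_div]
    _ ≤ renewal k / k := by gcongr; exact one_div_sqrt_le_renewal hk

theorem one_div_sqrt_le_mul_h {n : ℕ} (hn : n ≠ 0) : 1 / √n ≤ 2 * √2 * Real.exp 1 * h n := by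
  have tail_le : (n : ℝ) * (1 / (Real.exp 1 * √(2 * n) * (2 * n))) ≤ h n := by
    calc (n : ℝ) * (1 / (Real.exp 1 * √(2 * n) * (2 * n)))
        = ∑ _j ∈ range n, 1 / (Real.exp 1 * √(2 * n : ℕ) * (2 * n : ℕ)) := by simp
      _ ≤ ∑ j ∈ range n, borel (n + j + 1) := sum_le_sum fun j hj =>
          one_div_le_borel (Nat.succ_ne_zero _) (by have := mem_range.1 hj; omega)
      _ = h n - h (n + n) := (h_sub_h_add n n).symm
      _ ≤ h n := sub_le_self _ (h_nonneg _)
  calc 1 / √n = 2 * √2 * Real.exp 1 * (n * (1 / (Real.exp 1 * √(2 * n) * (2 * n)))) := by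
        rw [Real.sqrt_mul zero_le_two]
        field_simp
    _ ≤ 2 * √2 * Real.exp 1 * h n := by gcongr

theorem h_isTheta : Asymptotics.IsTheta atTop h (fun K : ℕ => 1 / √(K : ℝ)) := by
  constructor
  · refine Asymptotics.IsBigO.of_bound (Real.exp 1) ?_
    filter_upwards [eventually_ne_atTop 0] with n hn
    rw [Real.norm_of_nonneg (h_nonneg n), Real.norm_of_nonneg (by positivity)]
    exact h_le_exp_one_mul hn
  · refine Asymptotics.IsBigO.of_bound (2 * √2 * Real.exp 1) ?_
    filter_upwards [eventually_ne_atTop 0] with n hn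
    rw [Real.norm_of_nonneg (h_nonneg n), Real.norm_of_nonneg (by positivity)]
    exact one_div_sqrt_le_mul_h hn

/-! ### The law of large numbers -/

theorem ofReal_one_sub_le_measure_abs_sub_le {Ω : Type*} [MeasurableSpace Ω] {P : Measure Ω}
    [IsProbabilityMeasure P] {X : Ω → ℝ} (hX : MemLp X 2 P) (μ : ℝ) {δ : ℝ} (hδ : 0 < δ) :
    ENNReal.ofReal (1 - (P[X ^ 2] - 2 * μ * P[X] + μ ^ 2) / δ ^ 2) ≤ P {ω | |X ω - μ| ≤ δ} := by
  have markov : δ ^ 2 * P.real {ω | δ ^ 2 ≤ (X ω - μ) ^ 2} ≤ ∫ ω, (X ω - μ) ^ 2 ∂P :=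
    mul_meas_ge_le_integral_of_nonneg (ae_of_all _ fun ω => sq_nonneg _)
      (hX.sub (memLp_const μ)).integrable_sq (δ ^ 2)
  have integral_sub_sq : ∫ ω, (X ω - μ) ^ 2 ∂P = P[X ^ 2] - 2 * μ * P[X] + μ ^ 2 := by
    have integrable_X := (hX.integrable one_le_two).const_mul (2 * μ)
    have integrable_sub : Integrable (fun ω => X ω ^ 2 - 2 * μ * X ω) P :=
      hX.integrable_sq.sub integrable_X
    simp only [Pi.pow_apply, sub_sq, mul_right_comm (2 : ℝ) _ μ]
    rw [integral_add integrable_sub (integrable_const _),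
      integral_sub hX.integrable_sq integrable_X, integral_const_mul]
    simp
  rw [integral_sub_sq, ← le_div_iff₀' (by positivity)] at markov
  refine ENNReal.ofReal_le_of_le_toReal ?_
  have cover : 1 ≤ P.real {ω | |X ω - μ| ≤ δ} + P.real {ω | δ ^ 2 ≤ (X ω - μ) ^ 2} := by
    rw [← probReal_univ (μ := P)]
    refine (measureReal_mono fun ω _ => ?_).trans (measureReal_union_le _ _)
    obtain h | h := le_total |X ω - μ| δ
    · exact Or.inl h
    · exact Or.inr (by simpa using pow_le_pow_left₀ hδ.le h 2)
  change _ ≤ P.real _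
  linarith

theorem tendsto_measure_abs_sub_le {ι : Type*} {l : Filter ι} {Ω : ι → Type*}
    [∀ i, MeasurableSpace (Ω i)] {P : ∀ i, Measure (Ω i)} {X : ∀ i, Ω i → ℝ} {b : ι → ℝ} {μ δ : ℝ}
    (hP : ∀ᶠ i in l, IsProbabilityMeasure (P i)) (hX : ∀ᶠ i in l, MemLp (X i) 2 (P i))
    (mean : Tendsto (fun i => (P i)[X i]) l (𝓝 μ)) (sq_le : ∀ᶠ i in l, (P i)[X i ^ 2] ≤ b i)
    (hb : Tendsto b l (𝓝 (μ ^ 2))) (hδ : 0 < δ) :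
    Tendsto (fun i => P i {ω | |X i ω - μ| ≤ δ}) l (𝓝 1) := by
  have lower : Tendsto
      (fun i => ENNReal.ofReal (1 - (b i - 2 * μ * (P i)[X i] + μ ^ 2) / δ ^ 2)) l (𝓝 1) := by
    have variance := ((hb.sub (mean.const_mul (2 * μ))).add_const (μ ^ 2)).div_const (δ ^ 2)
    rw [show μ ^ 2 - 2 * μ * μ + μ ^ 2 = 0 by ring, zero_div] at variance
    simpa using ENNReal.tendsto_ofReal (variance.const_sub 1)
  refine tendsto_of_tendsto_of_tendsto_of_le_of_le' lower tendsto_const_nhds ?_ ?_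
  · filter_upwards [hP, hX, sq_le] with i hP hX sq_le
    refine le_trans ?_ (ofReal_one_sub_le_measure_abs_sub_le hX μ hδ)
    gcongr
  · filter_upwards [hP] with i hP
    exact prob_le_one

theorem integral_uniformOn {Ω : Type*} [MeasurableSpace Ω] [MeasurableSingletonClass Ω]
    (s : Finset Ω) (f : Ω → ℝ) : ∫ ω, f ω ∂uniformOn (s : Set Ω) = (∑ ω ∈ s, f ω) / #s := by
  have integrableOn : IntegrableOn f s Measure.count := by
    rw [← (s : Set Ω).biUnion_of_singleton]
    simp [integrableOn_finset_iUnion]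
  rw [uniformOn, ProbabilityTheory.cond, integral_smul_measure, setIntegral_finset _ integrableOn]
  simp [Measure.real, div_eq_inv_mul]

instance {V : Type*} [Countable V] : MeasurableSingletonClass (SimpleGraph V) where
  measurableSet_singleton G := by
    rw [← SimpleGraph.edgeSet_injective.preimage_image {G}, Set.image_singleton]
    exact SimpleGraph.measurable_edgeSet (measurableSet_singleton _)

theorem law_eq (n : ℕ) : law n = uniformOn (trees (Fin n) : Set (SimpleGraph (Fin n))) := by
  simp [law, trees]

theorem isProbabilityMeasure_law {n : ℕ} (hn : n ≠ 0) : IsProbabilityMeasure (law n) := by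
  refine isProbabilityMeasure_uniformOn (Set.toFinite _) ?_
  have : NeZero n := ⟨hn⟩
  obtain ⟨G, -, hG⟩ := (SimpleGraph.connected_top (V := Fin n)).exists_isTree_le
  exact ⟨G, hG⟩

theorem integral_law (n : ℕ) (f : SimpleGraph (Fin n) → ℝ) :
    ∫ G, f G ∂law n = (∑ G ∈ trees (Fin n), f G) / treeCount n := by
  rw [law_eq, integral_uniformOn, treeCount]

theorem integral_card_smallBranches_div (K n : ℕ) :
    ∫ G, (#(smallBranches K G) / n : ℝ) ∂law n = branchDensity K n := by
  have sum_card := sum_card_smallBranches (V := Fin n) K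
  rw [Fintype.card_fin] at sum_card
  rw [integral_law, ← sum_div, div_div, branchDensity, ← mul_treeCount, ← sum_card]
  push_cast
  rfl

theorem integral_card_smallBranches_div_sq_le {K n : ℕ} (hn : 2 * K < n) :
    ∫ G, (#(smallBranches K G) / n : ℝ) ^ 2 ∂law n ≤ secondMomentBound K n := by
  have sum_sq_le : (∑ G ∈ trees (Fin n), (#(smallBranches K G) : ℝ) ^ 2) ≤
      ∑ k ∈ range (K + 1),
        (n.choose k * (rootedCount k * ((n - k : ℕ) * branchTotal K (n - k))) : ℝ) +
        2 * K * branchTotal K n := by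
    have := sum_card_smallBranches_sq_le (V := Fin n) (K := K) (by simpa using hn)
    rw [Fintype.card_fin] at this
    exact_mod_cast this
  have n_ne : n ≠ 0 := by omega
  have count_ne := rootedCount_ne_zero n_ne
  calc ∫ G, (#(smallBranches K G) / n : ℝ) ^ 2 ∂law n
      = (∑ G ∈ trees (Fin n), (#(smallBranches K G) : ℝ) ^ 2) / (n * rootedCount n) := by
        simp only [div_pow]
        rw [integral_law, ← sum_div, ← mul_treeCount, div_div, Nat.cast_mul, sq (n : ℝ), mul_assoc]
    _ ≤ _ := by grw [sum_sq_le]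
    _ = ∑ k ∈ range (K + 1), ((n - k : ℕ) / n : ℝ) * (branchRatio k n * branchDensity K (n - k)) +
          (2 * K : ℝ) / n * branchDensity K n := by
        rw [add_div, sum_div]
        congr 1
        · refine sum_congr rfl fun k hk => ?_
          have := mem_range.1 hk
          have count_sub_ne := rootedCount_ne_zero (n := n - k) (by omega)
          rw [branchRatio, branchDensity]
          field_simp
        · rw [branchDensity]
          field_simp
    _ ≤ secondMomentBound K n := by
        refine add_le_add_left (sum_le_sum fun k _ => mul_le_of_le_one_left ?_ ?_) _
        · unfold branchRatio branchDensity
          positivity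
        · exact div_le_one_of_le₀ (mod_cast n.sub_le k) n.cast_nonneg

theorem tendsto_law_card_smallBranches (K : ℕ) {δ : ℝ} (hδ : 0 < δ) :
    Tendsto (fun n : ℕ => law n {G | |(#(smallBranches K G) / n : ℝ) - (1 - h K)| ≤ δ}) atTop
      (𝓝 1) := by
  refine tendsto_measure_abs_sub_le (P := law) (b := secondMomentBound K) ?_ ?_ ?_ ?_
    (tendsto_secondMomentBound K) hδ
  · exact (eventually_ne_atTop 0).mono fun n => isProbabilityMeasure_law
  · filter_upwards [eventually_ne_atTop 0] with n hn
    have := isProbabilityMeasure_law hn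
    exact .of_discrete
  · simpa only [integral_card_smallBranches_div] using tendsto_branchDensity K
  · exact (eventually_gt_atTop (2 * K)).mono fun n => integral_card_smallBranches_div_sq_le

/-! ### Internal vertices -/

theorem IsBranch.induce_deleteEdges {V : Type*} {G : SimpleGraph V} {S : Set V} {r w : V}
    (hb : IsBranch G S r w) : (G.deleteEdges {s(r, w)}).induce S = G.induce S := by
  ext x y
  have edge_ne : s((x : V), (y : V)) ≠ s(r, w) := fun heq => by
    obtain ⟨-, h⟩ | ⟨h, -⟩ := Sym2.eq_iff.1 heq
    · exact hb.parent_notMem (h ▸ y.2)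
    · exact hb.parent_notMem (h ▸ x.2)
  simp [edge_ne]

variable {n : ℕ} {G : SimpleGraph (Fin n)}

theorem IsBranch.branch_eq (hG : G.IsTree) {S : Set (Fin n)} {r w : Fin n}
    (hb : IsBranch G S r w) : branch G r w = S :=
  (isBranch_of_adj hG.isAcyclic hb.adj).side_unique hb hG.connected

theorem IsBranch.exists_isOfType (hG : G.IsTree) {S : Finset (Fin n)} {r w : Fin n}
    (hb : IsBranch G S r w) : ∃ (T : SimpleGraph (Fin #S)) (t : Fin #S), T.IsTree ∧
      IsOfType G r T t := by
  let e : Fin #S ≃o (S : Set (Fin n)) := S.orderIsoOfFin rfl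
  have isTree : (G.deleteEdges {s(r, w)}).induce (S : Set (Fin n)) |>.IsTree := by
    rw [hb.induce_deleteEdges]
    exact hb.isTree_induce hG
  refine ⟨(G.deleteEdges {s(r, w)}).comap fun i => (e i : Fin n), e.symm ⟨r, hb.root_mem⟩,
    (SimpleGraph.Iso.comap e.toEquiv _).isTree_iff.2 isTree, w, hb.adj, ?_⟩
  rw [hb.branch_eq hG]
  exact ⟨e, by simp, fun i j => Iff.rfl⟩

theorem notMem_internalVertices_iff {K : ℕ} (hG : G.IsTree) {v : Fin n} :
    v ∉ internalVertices K G ↔ ∃ c ∈ smallBranches K G, c.2.1 = v := by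
  classical
  rw [internalVertices, Set.mem_ofPred_eq, not_not]
  constructor
  · rintro ⟨k, hk, T, t, -, w, hadj, e, -⟩
    refine ⟨((branch G v w).toFinset, v, w), mem_smallBranches.2 ⟨?_, ?_⟩, rfl⟩
    · rw [Set.coe_toFinset]
      exact isBranch_of_adj hG.isAcyclic hadj
    · rwa [Set.toFinset_card, ← Fintype.card_congr e.toEquiv, Fintype.card_fin]
  · rintro ⟨c, hc, rfl⟩
    obtain ⟨hb, hcard⟩ := mem_smallBranches.1 hc
    exact ⟨_, hcard, hb.exists_isOfType hG⟩

theorem ncard_internalVertices_add_card_smallBranches {K : ℕ} (hn : 2 * K < n) (hG : G.IsTree) :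
    (internalVertices K G).ncard + #(smallBranches K G) = n := by
  have compl_eq : (internalVertices K G)ᶜ =
      (fun c : Finset (Fin n) × Fin n × Fin n => c.2.1) '' smallBranches K G := by
    ext v
    exact notMem_internalVertices_iff hG
  have injOn := injOn_root_smallBranches (K := K) (by simpa using hn) hG.connected
  rw [← Set.ncard_coe_finset, ← injOn.ncard_image, ← compl_eq, Set.ncard_add_ncard_compl,
    Nat.card_fin]

theorem abs_ncard_internalVertices_div_sub_one_le_iff {K : ℕ} (hn : 2 * K < n) (hG : G.IsTree)
    {ε : ℝ} : |((internalVertices K G).ncard : ℝ) / n / h K - 1| ≤ ε ↔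
      |(#(smallBranches K G) : ℝ) / n - (1 - h K)| ≤ ε * h K := by
  have n_ne : (n : ℝ) ≠ 0 := Nat.cast_ne_zero.2 (by omega)
  have h_ne := (h_pos K).ne'
  have cast_add : ((internalVertices K G).ncard : ℝ) + #(smallBranches K G) = n :=
    mod_cast ncard_internalVertices_add_card_smallBranches hn hG
  have deviation_eq : ((internalVertices K G).ncard : ℝ) / n / h K - 1 =
      -((#(smallBranches K G) : ℝ) / n - (1 - h K)) / h K := by
    rw [eq_sub_of_add_eq cast_add]
    field_simp
    ring
  rw [deviation_eq, abs_div, abs_neg, abs_of_pos (h_pos K), div_le_iff₀ (h_pos K)]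

theorem ae_law_isTree (n : ℕ) : ∀ᵐ G ∂law n, G.IsTree :=
  ProbabilityTheory.ae_cond_mem (Set.toFinite _).measurableSet

theorem tendsto_law_internalVertices (K : ℕ) {ε : ℝ} (hε : 0 < ε) :
    Tendsto (fun n : ℕ => law n {G | |((internalVertices K G).ncard : ℝ) / n / h K - 1| ≤ ε}) atTop
      (𝓝 1) := by
  refine (tendsto_law_card_smallBranches K (mul_pos hε (h_pos K))).congr' ?_
  filter_upwards [eventually_gt_atTop (2 * K)] with n hn
  refine MeasureTheory.measure_congr ?_
  filter_upwards [ae_law_isTree n] with G hG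
  exact propext (abs_ncard_internalVertices_div_sub_one_le_iff hn hG).symm

end RandomTree

theorem mainTheorem6 :
    (∀ K : ℕ, ∀ ε : ℝ, 0 < ε →
      Filter.Tendsto
        (fun n : ℕ => RandomTree.law n
          {G | |((RandomTree.internalVertices K G).ncard : ℝ) / (n : ℝ) / RandomTree.h K - 1| ≤ ε})
        Filter.atTop (nhds 1)) ∧
    Asymptotics.IsTheta Filter.atTop RandomTree.h (fun K : ℕ => 1 / Real.sqrt (K : ℝ)) :=
  ⟨fun K _ hε => RandomTree.tendsto_law_internalVertices K hε, RandomTree.h_isTheta⟩
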